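/- Let $K$ be a field and $\Sigma$ a finite alphabet. A weighted automaton is a tuple $A=(Q,s_0,\delta,f)$ with $Q$ a finite set, $s_0,f\colon Q\to K$ and $\delta\colon Q\times\Sigma\times Q\to K$. Put $\delta_a(p,q)=\delta(q,a,p)$ for $a\in\Sigma$, $\delta_\varepsilon=I$, $\delta_{wa}=\delta_a\delta_w$, and for $s\in K^Q$, $w \in \Sigma^*$ let $L_A[s](w)=f^{T}\delta_w s$; the language recognized by $A$ is $L_A=L_A[s_0]\colon\Sigma^*\to K$. Let $K\langle\Sigma^*\rangle$ be the vector space with basis $\Sigma^*$, let $r_A\colon K\langle\Sigma^*\rangle\to K^Q$ be the linear extension of $w\mapsto\delta_w s_0$, and let $o_A\colon K^Q\to \mathrm{Hom}(K\langle\Sigma^*\rangle,K)$ be the linear map sending $s$ to the linear extension of $L_A[s]$. - $A$ is minimal if $o_A$ is injective (i.e. $L_A[s]=0$ implies $s=0$). - A linear map $c\colon C\to K\langle\Sigma^*\rangle$ contains the empty word if the map $K\to K\langle\Sigma^*\rangle$, $\lambda\mapsto\lambda\varepsilon$, factors through $c$. - $P\subseteq\Sigma^*$ is a state cover for $A$ if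 the inclusion $p\colon\mathrm{span}(P)\to K\langle\Sigma^*\rangle$ contains the empty word and $r_A\circ p$ is a split epimorphism of vector spaces (equivalently: $\varepsilon\in P$ and the vectors $\delta_w s_0$, $w\in P$, span $K^Q$). - $W\subseteq\Sigma^*$ is a characterization set for $A$ if the inclusion $\iota\colon\mathrm{span}(W)\to K\langle\Sigma^*\rangle$ contains the empty word and, for all vector spaces $X$ and linear maps $g,h\colon X\to K^Q$, $\mathrm{Hom}(\iota,K)\circ o_A\circ g=\mathrm{Hom}(\iota,K)\circ o_A\circ h$ implies $o_A\circ g=o_A\circ h$ (equivalently: $\varepsilon\in W$ and, for all $s\in K^Q$, $L_A[s]|_W=0$ implies $L_A[s]=0$). - $T\subseteq\Sigma^*$ is complete for $S$ with respect to a collection $\mathcal U$ of weighted automata if for every $I\in\mathcal U$, $L_S|_T=L_I|_T$ implies $L_S=L_I$. **Theorem.** Let $S$ be a minimal weighted automaton over $K$ with input alphabet $\Sigma$. Then for every $P\subseteq\Sigma^*$, every characterization set $W\subseteq\Sigma^*$ for $S$ and every $k\in\mathbb N$, the test suite $P\cdot\Sigma^{\le k+1}\cdot W$ is complete for $S$ with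 respect to the collection of all weighted automata $I$ over $K$ with input alphabet $\Sigma$ for which $P\cdot\Sigma^{\le k}$ is a state cover, where $\Sigma^{\le m}$ is the set of words of length at most $m$. -/

import Mathlib

universe u v w w'

/-- A weighted automaton `(Q, s₀, δ, f)` over `K` with input alphabet `α`; `Q` is a finite set. -/
structure WeightedAutomaton (K : Type u) (α : Type v) where
  /-- the set of states -/
  Q : Type w
  [fintypeQ : Fintype Q]
  [decEqQ : DecidableEq Q]
  /-- input weight function -/
  s₀ : Q → K
  /-- transition weight function: `δ q a p` is the weight of the `a`-transition from `q` to `p` -/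
  δ : Q → α → Q → K
  /-- output weight function -/
  f : Q → K

attribute [instance] WeightedAutomaton.fintypeQ WeightedAutomaton.decEqQ

/-- The vector space with basis `α*`: the coproduct of the tensor powers of the free vector space
over the alphabet `α`. -/
abbrev WordSpace (K α : Type*) [Field K] := List α →₀ K

/-- The subspace of `WordSpace K α` spanned by a set of words. -/
noncomputable def spanWords (K : Type*) {α : Type*} [Field K] (T : Language α) :
    Submodule K (WordSpace K α) :=
  Submodule.span K {v | ∃ x ∈ T, Finsupp.single x (1 : K) = v}

/-- A linear map `a` into the word space contains the empty word: the map `K → WordSpace K α`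
sending `c` to `c • ε` factors through `a`. -/
def ContainsEmptyWord {K α X : Type*} [Field K] [AddCommMonoid X] [Module K X]
    (a : X →ₗ[K] WordSpace K α) : Prop :=
  ∃ i : K →ₗ[K] X, a ∘ₗ i = Finsupp.lsingle ([] : List α)

/-- The set of words of length at most `k`. -/
def wordsLE (α : Type*) (k : ℕ) : Language α := {w : List α | w.length ≤ k}

/-- The W test suite of order `k`: the set of words `P · Σ^{≤ k+1} · W`. -/
def wTestSuite {α : Type*} (k : ℕ) (P W : Language α) : Language α :=
  P * wordsLE α (k + 1) * W

namespace WeightedAutomaton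

variable {K : Type u} {α : Type v} [Field K]

/-- The matrix of the letter `a`: row index = target state, column index = source state. -/
def letterMatrix (A : WeightedAutomaton.{u, v, w} K α) (a : α) : Matrix A.Q A.Q K :=
  Matrix.of fun p q => A.δ q a p

/-- The matrix of a word: `δ_ε = 1` and `δ_{wa} = δ_a * δ_w`. -/
def wordMatrix (A : WeightedAutomaton.{u, v, w} K α) (x : List α) : Matrix A.Q A.Q K :=
  x.foldl (fun M a => A.letterMatrix a * M) 1

/-- The language recognized from the input weight vector `s`: `x ↦ fᵀ δ_x s`. -/
def langFrom (A : WeightedAutomaton.{u, v, w} K α) (s : A.Q → K) (x : List α) : K :=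
  A.f ⬝ᵥ (A.wordMatrix x).mulVec s

/-- The weighted language recognized by `A`. -/
def lang (A : WeightedAutomaton.{u, v, w} K α) : List α → K := A.langFrom A.s₀

/-- The linear extension of `x ↦ δ_x s₀` to the word space. -/
noncomputable def reach (A : WeightedAutomaton.{u, v, w} K α) : WordSpace K α →ₗ[K] (A.Q → K) :=
  Finsupp.linearCombination K fun x => (A.wordMatrix x).mulVec A.s₀

/-- The linear map that sends `s` to the linear extension of the language recognized from `s`. -/
noncomputable def observe (A : WeightedAutomaton.{u, v, w} K α) :
    (A.Q → K) →ₗ[K] (WordSpace K α →ₗ[K] K) where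
  toFun s := Finsupp.linearCombination K (A.langFrom s)
  map_add' s t := by
    ext x
    simp [langFrom, Matrix.mulVec_add, dotProduct_add]
  map_smul' c s := by
    ext x
    simp [langFrom, Matrix.mulVec_smul, dotProduct_smul]

/-- `A` is minimal (i.e. observable): `observe` is a monomorphism of vector spaces. -/
def IsMinimal (A : WeightedAutomaton.{u, v, w} K α) : Prop :=
  Function.Injective A.observe

/-- A linear map `p` into the word space is a state cover for `A`: it contains the empty word and
`reach ∘ p` is a split epimorphism of vector spaces. -/
def IsStateCoverMap (A : WeightedAutomaton.{u, v, w} K α) {X : Type*} [AddCommMonoid X] [Module K X]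
    (p : X →ₗ[K] WordSpace K α) : Prop :=
  ContainsEmptyWord p ∧ ∃ s : (A.Q → K) →ₗ[K] X, (A.reach ∘ₗ p) ∘ₗ s = LinearMap.id

/-- A linear map `c` into the word space is a characterization morphism for `A`: it contains the
empty word, and any two linear maps into the state space that are identified after observing
along `c` are identified after observing along all words. -/
def IsCharacterizationMap (A : WeightedAutomaton.{u, v, w} K α) {Y : Type*} [AddCommMonoid Y]
    [Module K Y] (c : Y →ₗ[K] WordSpace K α) : Prop :=
  ContainsEmptyWord c ∧
    ∀ (X : Type (max u w)) [AddCommGroup X] [Module K X] (g h : X →ₗ[K] (A.Q → K)),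
      LinearMap.lcomp K K c ∘ₗ A.observe ∘ₗ g = LinearMap.lcomp K K c ∘ₗ A.observe ∘ₗ h →
        A.observe ∘ₗ g = A.observe ∘ₗ h

/-- A set of words is a state cover if the inclusion of its span is one. -/
def IsStateCover (A : WeightedAutomaton.{u, v, w} K α) (P : Language α) : Prop :=
  A.IsStateCoverMap (spanWords K P).subtype

/-- A set of words is a characterization set if the inclusion of its span is a characterization
morphism. -/
def IsCharacterizationSet (A : WeightedAutomaton.{u, v, w} K α) (W : Language α) : Prop :=
  A.IsCharacterizationMap (spanWords K W).subtype

/-- The weighted automata for which `P · Σ^{≤ k}` is a state cover. -/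
def faultDomain (k : ℕ) (P : Language α) : Set (WeightedAutomaton.{u, v, w} K α) :=
  {I | I.IsStateCover (P * wordsLE α k)}

/-- The test suite `T` is complete for `S` with respect to the fault domain `U`: every automaton
in `U` that agrees with `S` on `T` recognizes the same language as `S`. -/
def IsCompleteTestSuite (T : Language α) (S : WeightedAutomaton.{u, v, w} K α)
    (U : Set (WeightedAutomaton.{u, v, w'} K α)) : Prop :=
  ∀ I ∈ U, (∀ x ∈ T, S.lang x = I.lang x) → S.lang = I.lang

end WeightedAutomaton

section Words

variable {K α : Type*} [Field K]

/-! Write `R` for the span of `P · Σ^{≤k}` and `R'` for that of `P · Σ^{≤k+1}`. A section `σ` of the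
reachability map of `I` on `R` turns each state of `I` into a formal sum of test words; running `S`
on that sum gives a linear map `φ` from the states of `I` to those of `S`. If `v ∈ R'`, then `σ
(I.reach v) - v` lies in `R'` and reaches `0` in `I`. Agreement on the suite makes the state it
reaches in `S` invisible on `W`, hence zero by minimality (`IsMinimal.eq_zero_of_observe_eq_zero`).
So `φ ∘ I.reach = S.reach` on `R'`, which makes `φ` a morphism of automata, and such a morphism
preserves the language (`lang_eq_of_linearMap`). -/

theorem single_mem_spanWords {T : Language α} {x : List α} (hx : x ∈ T) :
    Finsupp.single x (1 : K) ∈ spanWords K T :=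
  Submodule.subset_span ⟨x, hx, rfl⟩

theorem spanWords_mono {T T' : Language α} (h : ∀ x ∈ T, x ∈ T') :
    spanWords K T ≤ spanWords K T' := by
  refine Submodule.span_mono ?_
  rintro _ ⟨x, hx, rfl⟩
  exact ⟨x, h x hx, rfl⟩

theorem single_nil_mem_of_containsEmptyWord {p : Submodule K (WordSpace K α)}
    (h : ContainsEmptyWord p.subtype) : Finsupp.single ([] : List α) (1 : K) ∈ p := by
  obtain ⟨i, hi⟩ := h
  have := LinearMap.congr_fun hi 1
  simp only [LinearMap.comp_apply, Submodule.subtype_apply, Finsupp.lsingle_apply] at this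
  exact this ▸ (i 1).2

theorem mul_wordsLE_subset_succ (P : Language α) (k : ℕ) :
    ∀ x ∈ P * wordsLE α k, x ∈ P * wordsLE α (k + 1) := by
  rintro _ ⟨x, hx, y, hy, rfl⟩
  exact ⟨x, hx, y, Nat.le_succ_of_le hy, rfl⟩

theorem append_singleton_mem_mul_wordsLE {P : Language α} {k : ℕ} {x : List α}
    (hx : x ∈ P * wordsLE α k) (a : α) : x ++ [a] ∈ P * wordsLE α (k + 1) := by
  obtain ⟨x, hx, y, hy, rfl⟩ := hx
  have hy : y.length ≤ k := hy
  refine ⟨x, hx, y ++ [a], ?_, by simp⟩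
  change (y ++ [a]).length ≤ k + 1
  simpa using hy

/-- Right multiplication of formal sums of words by the letter `a`. -/
noncomputable def appendLetter (K : Type*) {α : Type*} [Field K] (a : α) :
    WordSpace K α →ₗ[K] WordSpace K α :=
  Finsupp.lmapDomain K K fun x => x ++ [a]

/-- This is the reason for the exponent `k + 1` in the suite: one transition out of a covered state
must still be tested. -/
theorem appendLetter_mem_spanWords {P : Language α} {k : ℕ} {v : WordSpace K α}
    (hv : v ∈ spanWords K (P * wordsLE α k)) (a : α) :
    appendLetter K a v ∈ spanWords K (P * wordsLE α (k + 1)) := by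
  suffices h : spanWords K (P * wordsLE α k) ≤
      (spanWords K (P * wordsLE α (k + 1))).comap (appendLetter K a) from h hv
  refine Submodule.span_le.2 ?_
  rintro _ ⟨x, hx, rfl⟩
  simpa [appendLetter, Finsupp.mapDomain_single] using
    single_mem_spanWords (K := K) (append_singleton_mem_mul_wordsLE hx a)

end Words

namespace WeightedAutomaton

variable {K : Type u} {α : Type v} [Field K]

@[simp]
theorem wordMatrix_nil (A : WeightedAutomaton.{u, v, w} K α) : A.wordMatrix [] = 1 := rfl

theorem wordMatrix_append_singleton (A : WeightedAutomaton.{u, v, w} K α) (x : List α) (a : α) :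
    A.wordMatrix (x ++ [a]) = A.letterMatrix a * A.wordMatrix x := by
  simp [wordMatrix, List.foldl_append]

theorem wordMatrix_append (A : WeightedAutomaton.{u, v, w} K α) (x y : List α) :
    A.wordMatrix (x ++ y) = A.wordMatrix y * A.wordMatrix x := by
  induction y using List.reverseRecOn with
  | nil => simp
  | append_singleton y a ih =>
    rw [← List.append_assoc, wordMatrix_append_singleton, wordMatrix_append_singleton, ih,
      Matrix.mul_assoc]

@[simp]
theorem reach_single (A : WeightedAutomaton.{u, v, w} K α) (x : List α) :
    A.reach (Finsupp.single x 1) = (A.wordMatrix x).mulVec A.s₀ := by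
  simp [reach]

@[simp]
theorem observe_single (A : WeightedAutomaton.{u, v, w} K α) (s : A.Q → K) (x : List α) :
    A.observe s (Finsupp.single x 1) = A.langFrom s x := by
  simp [observe]

/-- Hankel factorization: a test word splits into a prefix that reaches a state and a suffix that
observes it. -/
theorem observe_reach_single_single (A : WeightedAutomaton.{u, v, w} K α) (x y : List α) :
    A.observe (A.reach (Finsupp.single x 1)) (Finsupp.single y 1) = A.lang (x ++ y) := by
  simp [lang, langFrom, wordMatrix_append, Matrix.mulVec_mulVec]

theorem reach_appendLetter (A : WeightedAutomaton.{u, v, w} K α) (a : α) (v : WordSpace K α) :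
    A.reach (appendLetter K a v) = (A.letterMatrix a).mulVec (A.reach v) := by
  suffices h : A.reach ∘ₗ appendLetter K a = (A.letterMatrix a).mulVecLin ∘ₗ A.reach from
    LinearMap.congr_fun h v
  refine Finsupp.lhom_ext' fun x => LinearMap.ext_ring ?_
  simp [appendLetter, Finsupp.mapDomain_single, wordMatrix_append_singleton,
    Matrix.mulVec_mulVec]

/-- Agreement of two languages on `T · W` extends bilinearly to the spans. -/
theorem observe_reach_eq_of_lang_eq {S : WeightedAutomaton.{u, v, w} K α}
    {I : WeightedAutomaton.{u, v, w'} K α} {T W : Language α}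
    (h : ∀ x ∈ T * W, S.lang x = I.lang x) {v y : WordSpace K α}
    (hv : v ∈ spanWords K T) (hy : y ∈ spanWords K W) :
    S.observe (S.reach v) y = I.observe (I.reach v) y := by
  induction hv using Submodule.span_induction with
  | mem v hv =>
    obtain ⟨t, ht, rfl⟩ := hv
    induction hy using Submodule.span_induction with
    | mem y hy =>
      obtain ⟨z, hz, rfl⟩ := hy
      rw [observe_reach_single_single, observe_reach_single_single]
      exact h _ ⟨t, ht, z, hz, rfl⟩
    | zero => simp only [map_zero]
    | add y z _ _ hy hz => rw [map_add, map_add, hy, hz]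
    | smul c y _ hy => rw [map_smul, map_smul, hy]
  | zero => simp only [map_zero, LinearMap.zero_apply]
  | add v v' _ _ hv hv' => simp only [map_add, LinearMap.add_apply, hv, hv']
  | smul c v _ hv => simp only [map_smul, LinearMap.smul_apply, hv]

theorem IsMinimal.eq_zero_of_observe_eq_zero {S : WeightedAutomaton.{u, v, w} K α}
    (hS : S.IsMinimal) {W : Language α} (hW : S.IsCharacterizationSet W) {s : S.Q → K}
    (hs : ∀ y ∈ spanWords K W, S.observe s y = 0) : s = 0 := by
  -- The states invisible on `W`. Comparing the inclusion of this kernel with the zero map turns the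
  -- cancellation property into a statement about vectors.
  let N : Submodule K (S.Q → K) :=
    LinearMap.ker (LinearMap.lcomp K K (spanWords K W).subtype ∘ₗ S.observe)
  have hsN : s ∈ N := LinearMap.mem_ker.2 (LinearMap.ext fun y => hs y y.2)
  have h := hW.2 N N.subtype 0 (LinearMap.ext fun t =>
    (LinearMap.mem_ker.1 t.2).trans (by simp))
  have h' : S.observe s = 0 := by simpa using LinearMap.congr_fun h ⟨s, hsN⟩
  exact hS (h'.trans (map_zero _).symm)

/-- A linear map of state spaces that preserves input, transition and output weights preserves
the recognized language. -/
theorem lang_eq_of_linearMap {S : WeightedAutomaton.{u, v, w} K α}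
    {I : WeightedAutomaton.{u, v, w'} K α} (φ : (I.Q → K) →ₗ[K] (S.Q → K)) (h₀ : φ I.s₀ = S.s₀)
    (hδ : ∀ a s, φ ((I.letterMatrix a).mulVec s) = (S.letterMatrix a).mulVec (φ s))
    (hf : ∀ s, S.f ⬝ᵥ φ s = I.f ⬝ᵥ s) : S.lang = I.lang := by
  have key : ∀ x, φ ((I.wordMatrix x).mulVec I.s₀) = (S.wordMatrix x).mulVec S.s₀ := by
    intro x
    induction x using List.reverseRecOn with
    | nil => simpa using h₀
    | append_singleton x a ih =>
      rw [wordMatrix_append_singleton, wordMatrix_append_singleton, ← Matrix.mulVec_mulVec,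
        ← Matrix.mulVec_mulVec, hδ, ih]
  funext x
  rw [lang, lang, langFrom, langFrom, ← key, hf]

end WeightedAutomaton

open WeightedAutomaton in
theorem mainTheorem4 {K : Type u} {α : Type v} [Field K] [Finite α]
    (S : WeightedAutomaton.{u, v, w} K α) (hS : S.IsMinimal)
    (P W : Language α) (hW : S.IsCharacterizationSet W) (k : ℕ) :
    WeightedAutomaton.IsCompleteTestSuite (wTestSuite k P W) S
      (WeightedAutomaton.faultDomain.{u, v, w'} k P) := by
  rintro I ⟨hε, σ, hσ⟩ hT
  have hle : spanWords K (P * wordsLE α k) ≤ spanWords K (P * wordsLE α (k + 1)) :=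
    spanWords_mono (mul_wordsLE_subset_succ P k)
  have hsec : ∀ s, I.reach (σ s : WordSpace K α) = s := fun s => LinearMap.congr_fun hσ s
  -- Independence of the chosen section: `S.reach v` depends only on `I.reach v`.
  have hφ : ∀ v ∈ spanWords K (P * wordsLE α (k + 1)),
      S.reach (σ (I.reach v) : WordSpace K α) = S.reach v := by
    intro v hv
    rw [← sub_eq_zero, ← map_sub]
    refine hS.eq_zero_of_observe_eq_zero hW fun y hy => ?_
    rw [observe_reach_eq_of_lang_eq hT (Submodule.sub_mem _ (hle (σ _).2) hv) hy, map_sub, hsec,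
      sub_self, map_zero, LinearMap.zero_apply]
  have hεW := single_nil_mem_of_containsEmptyWord hW.1
  have hεR := hle (single_nil_mem_of_containsEmptyWord hε)
  refine lang_eq_of_linearMap (S.reach ∘ₗ (spanWords K (P * wordsLE α k)).subtype ∘ₗ σ) ?_ (fun a s => ?_) fun s => ?_
  -- Initial weights: take `v = ε`.
  · simpa using hφ _ hεR
  -- Transitions: take `v = σ s · a`, which reaches `δ_a s` in `I` and `δ_a (φ s)` in `S`.
  · have h := hφ _ (appendLetter_mem_spanWords (σ s).2 a)
    rw [reach_appendLetter, reach_appendLetter, hsec] at h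
    exact h
  -- Output weights: observing along `ε ∈ W` reads off `f`.
  · have h := observe_reach_eq_of_lang_eq hT (hle (σ s).2) hεW
    rw [hsec] at h
    simpa [langFrom] using h
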